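/- Let $n\ge 0$ and let $A,B\in\mathbb{C}^{n\times n}$, where $A$ has no eigenvalues on the closed negative real axis $\mathbb{R}_0^-=(-\infty,0]$. Then $A$ has a unique principal logarithm $\log(A)$, i.e. the equation $e^X=A$ has exactly one solution $X\in\mathbb{C}^{n\times n}$ all of whose eigenvalues $z$ satisfy $-\pi<\operatorname{Im} z<\pi$. Write $$A^B:=e^{\log(A)B},\qquad {}^{B}\!A:=e^{B\log(A)},\qquad f(A,B):=A^B,$$ and, for $\alpha\in\mathbb{R}$, let $A^\alpha$ denote the primary matrix function of $A$ with stem function the principal branch of $z\mapsto z^\alpha$ (that is, $A^\alpha=p(A)$ for any polynomial $p$ with $p^{(k)}(\lambda)=\frac{d^k}{dz^k}z^\alpha\big|_{z=\lambda}$ for each eigenvalue $\lambda$ of $A$ and each $k\geq 0$ smaller than the multiplicity of $\lambda$ in the minimal polynomial of $A$). The following hold, and the bases $I$ in (i), $A^B$ in (iii), $A^*$ in (v) and $SAS^{-1}$ in (vi) also have no eigenvalues on $\mathbb{R}_0^-$. (i) $A^0=I$ and $I^B=I$. (ii) $A^{\alpha I}=A^\alpha$ for every $\alpha\in\mathbb{R}$.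 In particular, $A^{\frac12 I}$ is the principal square root of $A$ (the unique $X$ with $X^2=A$ whose eigenvalues all have positive real part), and $A$ is invertible with $A^{-I}=A^{-1}$. (iii) If every eigenvalue $\lambda$ of $\log(A)B$ satisfies $-\pi<\operatorname{Im}\lambda<\pi$, then $A^{(BC)}=(A^B)^C$ for every $C\in\mathbb{C}^{n\times n}$. (iv) $A^{-B}A^B=A^BA^{-B}=I$, and therefore $(A^B)^{-1}=A^{-B}$. (v) $(A^B)^*={}^{B^*}\!(A^*)$, where $X^*$ is the conjugate transpose of $X$. (vi) If $S\in\mathbb{C}^{n\times n}$ is invertible, then $f(SAS^{-1},SBS^{-1})=S\,f(A,B)\,S^{-1}$. -/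

import Mathlib

noncomputable section

namespace MatrixPower

variable {n : ℕ}

/-- `A` has no eigenvalue on the closed negative real axis (`0` included). -/
def NoNonposEigenvalue (A : Matrix (Fin n) (Fin n) ℂ) : Prop :=
  ∀ r : ℝ, r ≤ 0 → (r : ℂ) ∉ spectrum ℂ A

/-- All eigenvalues of `X` lie in the open strip `-π < Im z < π`. -/
def SpectrumInStrip (X : Matrix (Fin n) (Fin n) ℂ) : Prop :=
  ∀ z ∈ spectrum ℂ X, -Real.pi < z.im ∧ z.im < Real.pi

/-- `X` is a principal logarithm of `A`: it solves `e ^ X = A` and its eigenvalues lie in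
the open strip `-π < Im z < π`. -/
def IsPrincipalLog (A X : Matrix (Fin n) (Fin n) ℂ) : Prop :=
  NormedSpace.exp X = A ∧ SpectrumInStrip X

open Classical in
/-- The principal logarithm `log A` (with value `0` if `A` has no principal logarithm). -/
def principalLog (A : Matrix (Fin n) (Fin n) ℂ) : Matrix (Fin n) (Fin n) ℂ :=
  if h : ∃ X, IsPrincipalLog A X then h.choose else 0

/-- The matrix-matrix exponentiation `A ^ B = e ^ (log(A) B)`. -/
def matPow (A B : Matrix (Fin n) (Fin n) ℂ) : Matrix (Fin n) (Fin n) ℂ :=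
  NormedSpace.exp (principalLog A * B)

/-- The other matrix-matrix exponentiation, `e ^ (B log(A))`, with the exponent written as a
left superscript. -/
def leftMatPow (A B : Matrix (Fin n) (Fin n) ℂ) : Matrix (Fin n) (Fin n) ℂ :=
  NormedSpace.exp (B * principalLog A)

/-- The polynomial `p` takes the values of `f` on the spectrum of `A`, in the sense of Hermite
interpolation: the derivatives of `p` and `f` agree at each eigenvalue `z` of `A` for all orders
below the multiplicity of `z` in the minimal polynomial, i.e. below the size of the largest
Jordan block of `A` for `z`. -/
def Interpolates (f : ℂ → ℂ) (A : Matrix (Fin n) (Fin n) ℂ) (p : Polynomial ℂ) : Prop :=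
  ∀ z ∈ spectrum ℂ A, ∀ k < (minpoly ℂ A).rootMultiplicity z,
    (Polynomial.derivative^[k] p).eval z = iteratedDeriv k f z

open Classical in
/-- The primary matrix function `f(A)` with scalar stem function `f`: it is `p(A)` for any
polynomial `p` that takes the values of `f` on the spectrum of `A` (any two such `p` differ by a
multiple of the minimal polynomial of `A`). -/
def primaryFunction (f : ℂ → ℂ) (A : Matrix (Fin n) (Fin n) ℂ) : Matrix (Fin n) (Fin n) ℂ :=
  if h : ∃ p : Polynomial ℂ, Interpolates f A p then Polynomial.aeval A h.choose else 0

/-- The real power `A ^ α` of a matrix: the primary matrix function with stem function the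
principal branch of `z ^ α`. -/
def realPow (A : Matrix (Fin n) (Fin n) ℂ) (α : ℝ) : Matrix (Fin n) (Fin n) ℂ :=
  primaryFunction (fun z : ℂ => z ^ (α : ℂ)) A

/-- `X` is a principal square root of `A`: a square root with all its eigenvalues in the open
right half-plane. -/
def IsPrincipalSqrt (A X : Matrix (Fin n) (Fin n) ℂ) : Prop :=
  X * X = A ∧ ∀ z ∈ spectrum ℂ X, 0 < z.re

end MatrixPower

end

/-!
The map `f ↦ primaryFunction f A` is a functional calculus. By Hermite interpolation `f(A)` is a
polynomial in `A` with spectrum `f(σ(A))`, and the chain rule for higher derivatives shows that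
`g(f(A)) = (g ∘ f)(A)` for `f`, `g` analytic at the relevant points. Since `f(A)` depends
continuously on finitely many derivatives of `f`, applying this to the Taylor polynomials of `exp`
identifies the primary function `exp(A)` with the exponential series. The identity
`exp ∘ log = id` on the slit plane then gives a principal logarithm, `log ∘ exp = id` on the strip
`|Im z| < π` gives its uniqueness, and principal square roots are obtained in the same way from
`z ^ 2` and `z ^ (1 / 2)`.
-/

namespace MatrixPower

open Filter Polynomial Topology

lemma rootMultiplicity_le_natDegree {R : Type*} [CommRing R] [IsDomain R] (p : R[X]) (a : R) :
    p.rootMultiplicity a ≤ p.natDegree := by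
  classical
  rw [← count_roots]
  exact (Multiset.count_le_card _ _).trans (card_roots' p)

section HermiteInterpolation

variable {K : Type*} [Field K]

lemma eval_iterate_derivative (p : K[X]) (a : K) (k : ℕ) :
    (derivative^[k] p).eval a = k.factorial * (taylor a p).coeff k := by
  rw [taylor_coeff, ← factorial_smul_hasseDeriv]
  simp

variable [CharZero K]

lemma X_sub_C_pow_dvd_iff_iterate_derivative {p : K[X]} {a : K} {m : ℕ} :
    (X - C a) ^ m ∣ p ↔ ∀ k < m, (derivative^[k] p).eval a = 0 := by
  rw [X_sub_C_pow_dvd_iff, ← taylor_apply, X_pow_dvd_iff]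
  refine forall₂_congr fun k _ => ?_
  simp [eval_iterate_derivative, k.factorial_ne_zero]

lemma dvd_of_forall_iterate_derivative_eval_eq_zero {p q : K[X]} (hp : p.Splits) (hp0 : p ≠ 0)
    (h : ∀ a, ∀ k < p.rootMultiplicity a, (derivative^[k] q).eval a = 0) : p ∣ q := by
  classical
  by_cases hq : q = 0
  · simp [hq]
  rw [hp.dvd_iff_roots_le_roots hp0 hq, Multiset.le_iff_count]
  intro a
  rw [count_roots, count_roots, le_rootMultiplicity_iff hq]
  exact X_sub_C_pow_dvd_iff_iterate_derivative.2 (h a)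

lemma exists_forall_iterate_derivative_eval_eq_at (a : K) (m : ℕ) (c : ℕ → K) :
    ∃ p : K[X], ∀ k < m, (derivative^[k] p).eval a = c k := by
  refine ⟨taylor (-a) (∑ k ∈ Finset.range m, monomial k (c k / k.factorial)), fun k hk => ?_⟩
  rw [eval_iterate_derivative, taylor_taylor, add_neg_cancel, taylor_zero]
  simp [coeff_monomial, hk, mul_div_cancel₀, Nat.factorial_ne_zero]

lemma exists_forall_iterate_derivative_eval_eq {s : Set K} (hs : s.Finite) (m : ℕ)
    (c : K → ℕ → K) : ∃ p : K[X], ∀ a ∈ s, ∀ k < m, (derivative^[k] p).eval a = c a k := by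
  have := hs.to_subtype
  choose t ht using fun a : s => exists_forall_iterate_derivative_eval_eq_at (a : K) m (c a)
  have hcoprime : Pairwise (Function.onFun IsCoprime
      fun a : s => Ideal.span {(X - C (a : K)) ^ m}) := fun a b hab => by
    rw [Function.onFun, Ideal.isCoprime_span_singleton_iff]
    exact (pairwise_coprime_X_sub_C Subtype.val_injective hab).pow
  obtain ⟨p, hp⟩ := Ideal.exists_forall_sub_mem_ideal hcoprime t
  refine ⟨p, fun a ha k hk => ?_⟩
  have hpt := X_sub_C_pow_dvd_iff_iterate_derivative.1
    (Ideal.mem_span_singleton.1 (hp ⟨a, ha⟩)) k hk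
  rw [iterate_derivative_sub, eval_sub, sub_eq_zero] at hpt
  rw [hpt, ht ⟨a, ha⟩ k hk]

end HermiteInterpolation

section IteratedDeriv

variable {𝕜 : Type*} [NontriviallyNormedField 𝕜]

lemma iteratedDeriv_eval (p : 𝕜[X]) (k : ℕ) (a : 𝕜) :
    iteratedDeriv k (fun z => p.eval z) a = (derivative^[k] p).eval a := by
  induction k generalizing p with
  | zero => simp
  | succ k ih =>
    have hderiv : deriv (fun z => p.eval z) = fun z => p.derivative.eval z := by
      ext z
      exact p.deriv
    rw [Function.iterate_succ_apply, iteratedDeriv_succ', hderiv, ih]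

lemma iteratedDeriv_comp_congr {f₁ f₂ g₁ g₂ : 𝕜 → 𝕜} {a : 𝕜} {k : ℕ}
    (hf₁ : ContDiffAt 𝕜 k f₁ a) (hf₂ : ContDiffAt 𝕜 k f₂ a)
    (hg₁ : ContDiffAt 𝕜 k g₁ (f₂ a)) (hg₂ : ContDiffAt 𝕜 k g₂ (f₂ a))
    (hf : ∀ i ≤ k, iteratedDeriv i f₁ a = iteratedDeriv i f₂ a)
    (hg : ∀ i ≤ k, iteratedDeriv i g₁ (f₂ a) = iteratedDeriv i g₂ (f₂ a)) :
    iteratedDeriv k (g₁ ∘ f₁) a = iteratedDeriv k (g₂ ∘ f₂) a := by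
  have hfa : f₁ a = f₂ a := by simpa using hf 0 k.zero_le
  rw [iteratedDeriv_comp_eq_sum_orderedFinpartition (hfa ▸ hg₁) hf₁ le_rfl,
    iteratedDeriv_comp_eq_sum_orderedFinpartition hg₂ hf₂ le_rfl]
  refine Finset.sum_congr rfl fun c _ => ?_
  rw [hfa, hg _ c.length_le]
  congr 1
  exact Finset.prod_congr rfl fun j _ => hf _ (c.partSize_le j)

end IteratedDeriv

lemma spectrum_aeval {K E : Type*} [Field K] [IsAlgClosed K] [Ring E] [Algebra K E]
    [FiniteDimensional K E] (a : E) (p : K[X]) :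
    spectrum K (aeval a p) = (fun z => p.eval z) '' spectrum K a := by
  cases subsingleton_or_nontrivial E with
  | inl _ => simp [spectrum.of_subsingleton]
  | inr _ =>
    exact spectrum.map_polynomial_aeval_of_nonempty a p
      (spectrum.nonempty_of_isAlgClosed_of_finiteDimensional K a)

section Minpoly

variable {K m : Type*} [Field K] [Fintype m] [DecidableEq m]

lemma minpoly_ne_zero (A : Matrix m m K) : minpoly K A ≠ 0 :=
  minpoly.ne_zero A.isIntegral

lemma rootMultiplicity_minpoly_pos_iff {A : Matrix m m K} {z : K} :
    0 < (minpoly K A).rootMultiplicity z ↔ z ∈ spectrum K A := by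
  rw [rootMultiplicity_pos (minpoly_ne_zero A), ← Matrix.minpoly_toLin',
    ← Module.End.hasEigenvalue_iff_isRoot, Module.End.hasEigenvalue_iff_mem_spectrum,
    Matrix.spectrum_toLin']

end Minpoly

section PrimaryFunction

variable {n : ℕ} {A : Matrix (Fin n) (Fin n) ℂ} {f g : ℂ → ℂ}

lemma Interpolates.aeval_eq {p q : ℂ[X]} (hp : Interpolates f A p) (hq : Interpolates f A q) :
    aeval A p = aeval A q := by
  rw [← sub_eq_zero, ← map_sub]
  refine aeval_eq_zero_of_dvd_aeval_eq_zero
    (dvd_of_forall_iterate_derivative_eval_eq_zero (IsAlgClosed.splits _) (minpoly_ne_zero A)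
      fun z k hk => ?_) (minpoly.aeval ℂ A)
  have hz : z ∈ spectrum ℂ A := rootMultiplicity_minpoly_pos_iff.1 (k.zero_le.trans_lt hk)
  rw [iterate_derivative_sub, eval_sub, hp z hz k hk, hq z hz k hk, sub_self]

lemma Interpolates.primaryFunction_eq {p : ℂ[X]} (hp : Interpolates f A p) :
    primaryFunction f A = aeval A p := by
  have hex : ∃ p, Interpolates f A p := ⟨p, hp⟩
  rw [primaryFunction, dif_pos hex]
  exact hex.choose_spec.aeval_eq hp

lemma exists_interpolates_of_order (f : ℂ → ℂ) (A : Matrix (Fin n) (Fin n) ℂ) {m : ℕ}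
    (hm : (minpoly ℂ A).natDegree ≤ m) :
    ∃ p : ℂ[X], Interpolates f A p ∧
      ∀ z ∈ spectrum ℂ A, ∀ k < m, (derivative^[k] p).eval z = iteratedDeriv k f z := by
  obtain ⟨p, hp⟩ := exists_forall_iterate_derivative_eval_eq A.finite_spectrum m
    fun z k => iteratedDeriv k f z
  exact ⟨p, fun z hz k hk =>
    hp z hz k (hk.trans_le ((rootMultiplicity_le_natDegree _ z).trans hm)), hp⟩

lemma primaryFunction_eval (A : Matrix (Fin n) (Fin n) ℂ) (p : ℂ[X]) :
    primaryFunction (fun z => p.eval z) A = aeval A p :=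
  Interpolates.primaryFunction_eq fun _ _ _ _ => (iteratedDeriv_eval p _ _).symm

lemma primaryFunction_congr (h : ∀ z ∈ spectrum ℂ A, f =ᶠ[𝓝 z] g) :
    primaryFunction f A = primaryFunction g A := by
  obtain ⟨p, hp, -⟩ := exists_interpolates_of_order f A le_rfl
  have hpg : Interpolates g A p := fun z hz k hk =>
    (hp z hz k hk).trans ((h z hz).iteratedDeriv_eq k)
  rw [hp.primaryFunction_eq, hpg.primaryFunction_eq]

theorem spectrum_primaryFunction (f : ℂ → ℂ) (A : Matrix (Fin n) (Fin n) ℂ) :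
    spectrum ℂ (primaryFunction f A) = f '' spectrum ℂ A := by
  obtain ⟨p, hp, -⟩ := exists_interpolates_of_order f A le_rfl
  rw [hp.primaryFunction_eq, spectrum_aeval]
  refine Set.image_congr fun z hz => ?_
  simpa using hp z hz 0 (rootMultiplicity_minpoly_pos_iff.2 hz)

theorem primaryFunction_comp (hf : ∀ z ∈ spectrum ℂ A, AnalyticAt ℂ f z)
    (hg : ∀ z ∈ spectrum ℂ A, AnalyticAt ℂ g (f z)) :
    primaryFunction (fun z => g (f z)) A = primaryFunction g (primaryFunction f A) := by
  set D := primaryFunction f A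
  obtain ⟨p, hp, hpm⟩ := exists_interpolates_of_order f A
    (le_max_left (minpoly ℂ A).natDegree (minpoly ℂ D).natDegree)
  obtain ⟨q, hq, hqm⟩ := exists_interpolates_of_order g D
    (le_max_right (minpoly ℂ A).natDegree (minpoly ℂ D).natDegree)
  have hqp : Interpolates (fun z => g (f z)) A (q.comp p) := fun z hz k hk => by
    have hkm : k < max (minpoly ℂ A).natDegree (minpoly ℂ D).natDegree :=
      hk.trans_le ((rootMultiplicity_le_natDegree _ z).trans (le_max_left _ _))
    have hfz : f z ∈ spectrum ℂ D := spectrum_primaryFunction f A ▸ Set.mem_image_of_mem f hz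
    have hsmooth (r : ℂ[X]) (w : ℂ) : ContDiffAt ℂ k (fun w => r.eval w) w :=
      (r.differentiable.analyticAt w).contDiffAt
    simp only [← iteratedDeriv_eval, eval_comp]
    refine iteratedDeriv_comp_congr (hsmooth p z) (hf z hz).contDiffAt (hsmooth q (f z))
      (hg z hz).contDiffAt (fun i hi => ?_) (fun i hi => ?_)
    · rw [iteratedDeriv_eval, hpm z hz i (hi.trans_lt hkm)]
    · rw [iteratedDeriv_eval, hqm _ hfz i (hi.trans_lt hkm)]
  rw [hqp.primaryFunction_eq, hq.primaryFunction_eq, aeval_comp, ← hp.primaryFunction_eq]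

lemma primaryFunction_id (A : Matrix (Fin n) (Fin n) ℂ) : primaryFunction id A = A := by
  simpa [Function.id_def] using primaryFunction_eval A X

lemma primaryFunction_const_mul (c : ℂ) (A : Matrix (Fin n) (Fin n) ℂ) :
    primaryFunction (fun z => c * z) A = c • A := by
  have h := primaryFunction_eval A (C c * X)
  rw [map_mul, aeval_C, aeval_X, ← Algebra.smul_def] at h
  simpa only [eval_C_mul, eval_X] using h

lemma primaryFunction_pow (m : ℕ) (A : Matrix (Fin n) (Fin n) ℂ) :
    primaryFunction (fun z => z ^ m) A = A ^ m := by
  simpa using primaryFunction_eval A (X ^ m)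

lemma primaryFunction_primaryFunction_of_leftInverse
    (hf : ∀ z ∈ spectrum ℂ A, AnalyticAt ℂ f z)
    (hg : ∀ z ∈ spectrum ℂ A, AnalyticAt ℂ g (f z))
    (hgf : ∀ z ∈ spectrum ℂ A, ∀ᶠ w in 𝓝 z, g (f w) = w) :
    primaryFunction g (primaryFunction f A) = A := by
  rw [← primaryFunction_comp hf hg, primaryFunction_congr hgf]
  exact primaryFunction_id A

/-- The matrices `Z z k` are the components of `A`; what matters is that they do not depend
on `f`, so that `f(A)` is a continuous function of finitely many derivatives of `f`. -/
lemma exists_primaryFunction_eq_sum (A : Matrix (Fin n) (Fin n) ℂ) :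
    ∃ Z : ℂ → ℕ → Matrix (Fin n) (Fin n) ℂ, ∀ f : ℂ → ℂ, primaryFunction f A =
      ∑ z ∈ A.finite_spectrum.toFinset, ∑ k ∈ Finset.range ((minpoly ℂ A).rootMultiplicity z),
        iteratedDeriv k f z • Z z k := by
  classical
  choose e he using fun (z : ℂ) (k : ℕ) => exists_forall_iterate_derivative_eval_eq
    A.finite_spectrum (minpoly ℂ A).natDegree fun w j => if w = z ∧ j = k then 1 else 0
  refine ⟨fun z k => aeval A (e z k), fun f => ?_⟩
  have hinterp : Interpolates f A (∑ z ∈ A.finite_spectrum.toFinset,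
      ∑ k ∈ Finset.range ((minpoly ℂ A).rootMultiplicity z), iteratedDeriv k f z • e z k) := by
    intro w hw j hj
    have hj' := hj.trans_le (rootMultiplicity_le_natDegree _ w)
    simp only [iterate_derivative_sum, iterate_derivative_smul, eval_finsetSum, eval_smul,
      he _ _ w hw j hj', ite_and]
    simp [hw, hj]
  rw [hinterp.primaryFunction_eq]
  simp only [map_sum, map_smul]

lemma tendsto_primaryFunction {ι : Type*} {l : Filter ι} {F : ι → ℂ → ℂ}
    (h : ∀ z ∈ spectrum ℂ A, ∀ k < (minpoly ℂ A).rootMultiplicity z,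
      Tendsto (fun i => iteratedDeriv k (F i) z) l (𝓝 (iteratedDeriv k f z))) :
    Tendsto (fun i => primaryFunction (F i) A) l (𝓝 (primaryFunction f A)) := by
  obtain ⟨Z, hZ⟩ := exists_primaryFunction_eq_sum A
  simp only [hZ]
  refine tendsto_finsetSum _ fun z hz => tendsto_finsetSum _ fun k hk => ?_
  exact (h z (by simpa using hz) k (by simpa using hk)).smul_const (Z z k)

end PrimaryFunction

section Exponential

lemma tendsto_aeval_trunc_exp {𝕜 E : Type*} [RCLike 𝕜] [NormedRing E] [NormedAlgebra 𝕜 E]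
    [CompleteSpace E] (a : E) :
    Tendsto (fun N => aeval a (PowerSeries.trunc N (PowerSeries.exp 𝕜))) atTop
      (𝓝 (NormedSpace.exp a)) := by
  have hsum := (NormedSpace.exp_series_hasSum_exp' (𝕂 := 𝕜) a).tendsto_sum_nat
  refine hsum.congr fun N => ?_
  simp [aeval_def, PowerSeries.eval₂_trunc_eq_sum_range, PowerSeries.coeff_exp, Algebra.smul_def]

lemma iterate_derivative_trunc_exp {R : Type*} [CommRing R] [Algebra ℚ R] (N k : ℕ) :
    derivative^[k] (PowerSeries.trunc (N + k) (PowerSeries.exp R)) =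
      PowerSeries.trunc N (PowerSeries.exp R) := by
  induction k with
  | zero => rfl
  | succ k ih =>
    rw [Function.iterate_succ_apply, ← add_assoc, ← PowerSeries.trunc_derivative,
      PowerSeries.derivative_exp, ih]

variable {n : ℕ}

theorem primaryFunction_exp (A : Matrix (Fin n) (Fin n) ℂ) :
    primaryFunction Complex.exp A = NormedSpace.exp A := by
  open scoped Matrix.Norms.Operator in
  refine tendsto_nhds_unique (tendsto_primaryFunction fun z _ k _ => ?_)
    ((tendsto_aeval_trunc_exp (𝕜 := ℂ) A).congr fun N => (primaryFunction_eval A _).symm)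
  have hlim := tendsto_aeval_trunc_exp (𝕜 := ℂ) z
  rw [← Complex.exp_eq_exp_ℂ] at hlim
  rw [← tendsto_add_atTop_iff_nat k]
  simpa [iteratedDeriv_eval, iterate_derivative_trunc_exp, iteratedDeriv_eq_iterate,
    Complex.iter_deriv_exp] using hlim

lemma spectrum_exp (A : Matrix (Fin n) (Fin n) ℂ) :
    spectrum ℂ (NormedSpace.exp A) = Complex.exp '' spectrum ℂ A := by
  rw [← primaryFunction_exp, spectrum_primaryFunction]

lemma exp_primaryFunction {A : Matrix (Fin n) (Fin n) ℂ} {f : ℂ → ℂ}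
    (hf : ∀ z ∈ spectrum ℂ A, AnalyticAt ℂ f z) :
    NormedSpace.exp (primaryFunction f A) = primaryFunction (fun z => Complex.exp (f z)) A := by
  rw [← primaryFunction_exp, ← primaryFunction_comp hf fun _ _ => analyticAt_cexp]

end Exponential

section PrincipalLog

variable {n : ℕ} {A X : Matrix (Fin n) (Fin n) ℂ}

lemma noNonposEigenvalue_iff_spectrum_subset_slitPlane :
    NoNonposEigenvalue A ↔ spectrum ℂ A ⊆ Complex.slitPlane := by
  refine ⟨fun hA z hz => ?_, fun hA r hr hmem => ?_⟩
  · by_contra hslit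
    obtain ⟨hre, him⟩ : z.re ≤ 0 ∧ z.im = 0 := by
      simpa [Complex.mem_slitPlane_iff] using hslit
    have hz' : (z.re : ℂ) = z := Complex.ext rfl him.symm
    exact hA z.re hre (hz' ▸ hz)
  · exact hr.not_gt (Complex.ofReal_mem_slitPlane.1 (hA hmem))

lemma NoNonposEigenvalue.mem_slitPlane (hA : NoNonposEigenvalue A) {z : ℂ}
    (hz : z ∈ spectrum ℂ A) : z ∈ Complex.slitPlane :=
  noNonposEigenvalue_iff_spectrum_subset_slitPlane.1 hA hz

lemma NoNonposEigenvalue.isUnit (hA : NoNonposEigenvalue A) : IsUnit A :=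
  spectrum.isUnit_of_zero_notMem ℂ (by simpa using hA 0 le_rfl)

lemma SpectrumInStrip.noNonposEigenvalue_exp (hX : SpectrumInStrip X) :
    NoNonposEigenvalue (NormedSpace.exp X) := by
  rw [noNonposEigenvalue_iff_spectrum_subset_slitPlane, spectrum_exp]
  rintro _ ⟨z, hz, rfl⟩
  obtain ⟨hlt, hgt⟩ := hX z hz
  rw [Complex.mem_slitPlane_iff_arg, ← Complex.log_im, Complex.log_exp hlt hgt.le]
  exact ⟨hgt.ne, Complex.exp_ne_zero z⟩

lemma SpectrumInStrip.primaryFunction_log_exp (hX : SpectrumInStrip X) :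
    primaryFunction Complex.log (NormedSpace.exp X) = X := by
  have hA := hX.noNonposEigenvalue_exp
  rw [← primaryFunction_exp] at hA ⊢
  refine primaryFunction_primaryFunction_of_leftInverse (fun _ _ => analyticAt_cexp)
    (fun z hz => analyticAt_clog (hA.mem_slitPlane ?_)) fun z hz => ?_
  · rw [spectrum_primaryFunction]
    exact Set.mem_image_of_mem _ hz
  · filter_upwards [Complex.continuous_im.continuousAt.eventually
      (Ioo_mem_nhds (hX z hz).1 (hX z hz).2)] with w hw
    exact Complex.log_exp hw.1 hw.2.le

lemma NoNonposEigenvalue.isPrincipalLog_primaryFunction_log (hA : NoNonposEigenvalue A) :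
    IsPrincipalLog A (primaryFunction Complex.log A) := by
  constructor
  · rw [← primaryFunction_exp]
    refine primaryFunction_primaryFunction_of_leftInverse
      (fun z hz => analyticAt_clog (hA.mem_slitPlane hz)) (fun _ _ => analyticAt_cexp)
      fun z hz => ?_
    filter_upwards [Complex.isOpen_slitPlane.mem_nhds (hA.mem_slitPlane hz)] with w hw
    exact Complex.exp_log (Complex.slitPlane_ne_zero hw)
  · rw [SpectrumInStrip, spectrum_primaryFunction]
    rintro _ ⟨z, hz, rfl⟩
    rw [Complex.log_im]
    exact ⟨Complex.neg_pi_lt_arg z, (Complex.arg_le_pi z).lt_of_ne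
      (Complex.mem_slitPlane_iff_arg.1 (hA.mem_slitPlane hz)).1⟩

theorem existsUnique_isPrincipalLog (hA : NoNonposEigenvalue A) : ∃! X, IsPrincipalLog A X := by
  refine ⟨_, hA.isPrincipalLog_primaryFunction_log, ?_⟩
  rintro X ⟨rfl, hX⟩
  exact hX.primaryFunction_log_exp.symm

lemma isPrincipalLog_principalLog (hA : NoNonposEigenvalue A) :
    IsPrincipalLog A (principalLog A) := by
  have hex : ∃ X, IsPrincipalLog A X := (existsUnique_isPrincipalLog hA).exists
  rw [principalLog, dif_pos hex]
  exact hex.choose_spec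

lemma IsPrincipalLog.principalLog_eq (hX : IsPrincipalLog A X) : principalLog A = X := by
  have hA : NoNonposEigenvalue A := hX.1 ▸ hX.2.noNonposEigenvalue_exp
  exact (existsUnique_isPrincipalLog hA).unique (isPrincipalLog_principalLog hA) hX

lemma principalLog_eq_primaryFunction (hA : NoNonposEigenvalue A) :
    principalLog A = primaryFunction Complex.log A :=
  hA.isPrincipalLog_primaryFunction_log.principalLog_eq

lemma isPrincipalLog_one : IsPrincipalLog (1 : Matrix (Fin n) (Fin n) ℂ) 0 := by
  refine ⟨NormedSpace.exp_zero, fun z hz => ?_⟩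
  obtain ⟨_, -, rfl⟩ :
      z ∈ (fun w => (0 : ℂ[X]).eval w) '' spectrum ℂ (0 : Matrix (Fin n) (Fin n) ℂ) := by
    rwa [← spectrum_aeval, map_zero]
  simp [Real.pi_pos]

lemma noNonposEigenvalue_one : NoNonposEigenvalue (1 : Matrix (Fin n) (Fin n) ℂ) :=
  isPrincipalLog_one.1 ▸ isPrincipalLog_one.2.noNonposEigenvalue_exp

lemma exp_smul_principalLog (hA : NoNonposEigenvalue A) (c : ℂ) :
    NormedSpace.exp (c • principalLog A) = primaryFunction (fun z => z ^ c) A := by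
  have hlog : ∀ z ∈ spectrum ℂ A, AnalyticAt ℂ Complex.log z :=
    fun z hz => analyticAt_clog (hA.mem_slitPlane hz)
  rw [principalLog_eq_primaryFunction hA, ← primaryFunction_const_mul,
    ← primaryFunction_comp hlog fun _ _ => by fun_prop,
    exp_primaryFunction (f := fun z => c * Complex.log z)
      fun z hz => analyticAt_const.mul (hlog z hz)]
  refine primaryFunction_congr fun z hz => ?_
  filter_upwards [Complex.isOpen_slitPlane.mem_nhds (hA.mem_slitPlane hz)] with w hw
  rw [Complex.cpow_def_of_ne_zero (Complex.slitPlane_ne_zero hw), mul_comm]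

end PrincipalLog

section PrincipalSqrt

variable {n : ℕ} {A X : Matrix (Fin n) (Fin n) ℂ}

lemma re_cpow_two_inv_pos {z : ℂ} (hz : z ∈ Complex.slitPlane) : 0 < (z ^ (2⁻¹ : ℂ)).re := by
  rw [Complex.cpow_inv_two_re, Real.sqrt_pos]
  rcases hz with hre | him
  · positivity
  · linarith [neg_le_abs z.re, Complex.abs_re_lt_norm.2 him]

lemma sq_mem_slitPlane {z : ℂ} (hz : 0 < z.re) : z ^ 2 ∈ Complex.slitPlane := by
  rw [Complex.mem_slitPlane_iff_not_le_zero, Complex.sq_nonpos_iff]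
  exact hz.ne'

lemma analyticAt_cpow_const {z : ℂ} (hz : z ∈ Complex.slitPlane) (c : ℂ) :
    AnalyticAt ℂ (fun w => w ^ c) z :=
  analyticAt_id.cpow analyticAt_const hz

lemma NoNonposEigenvalue.isPrincipalSqrt_primaryFunction (hA : NoNonposEigenvalue A) :
    IsPrincipalSqrt A (primaryFunction (fun z => z ^ (2⁻¹ : ℂ)) A) := by
  constructor
  · rw [← pow_two, ← primaryFunction_pow]
    exact primaryFunction_primaryFunction_of_leftInverse
      (fun z hz => analyticAt_cpow_const (hA.mem_slitPlane hz) _) (fun _ _ => by fun_prop)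
      fun _ _ => .of_forall fun w => Complex.cpow_ofNat_inv_pow w 2
  · rw [spectrum_primaryFunction]
    rintro _ ⟨z, hz, rfl⟩
    exact re_cpow_two_inv_pos (hA.mem_slitPlane hz)

lemma IsPrincipalSqrt.eq_primaryFunction (hX : IsPrincipalSqrt A X) :
    X = primaryFunction (fun z => z ^ (2⁻¹ : ℂ)) A := by
  obtain ⟨rfl, hre⟩ := hX
  rw [← pow_two, ← primaryFunction_pow]
  refine (primaryFunction_primaryFunction_of_leftInverse (fun _ _ => by fun_prop)
    (fun z hz => analyticAt_cpow_const (sq_mem_slitPlane (hre z hz)) _) fun z hz => ?_).symm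
  filter_upwards [Complex.continuous_re.continuousAt.eventually (lt_mem_nhds (hre z hz))] with w hw
  exact Complex.sq_cpow_two_inv hw

theorem isPrincipalSqrt_iff (hA : NoNonposEigenvalue A) :
    IsPrincipalSqrt A X ↔ X = primaryFunction (fun z => z ^ (2⁻¹ : ℂ)) A :=
  ⟨IsPrincipalSqrt.eq_primaryFunction, fun h => h ▸ hA.isPrincipalSqrt_primaryFunction⟩

end PrincipalSqrt

section Covariance

variable {n : ℕ} {A S : Matrix (Fin n) (Fin n) ℂ}

lemma spectrum_conjTranspose (A : Matrix (Fin n) (Fin n) ℂ) :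
    spectrum ℂ A.conjTranspose = star (spectrum ℂ A) :=
  spectrum.map_star A

lemma NoNonposEigenvalue.conjTranspose (hA : NoNonposEigenvalue A) :
    NoNonposEigenvalue A.conjTranspose := by
  intro r hr hmem
  rw [spectrum_conjTranspose, Set.mem_star] at hmem
  exact hA r hr (by simpa using hmem)

lemma principalLog_conjTranspose (hA : NoNonposEigenvalue A) :
    principalLog A.conjTranspose = (principalLog A).conjTranspose := by
  obtain ⟨hexp, hstrip⟩ := isPrincipalLog_principalLog hA
  refine IsPrincipalLog.principalLog_eq ⟨by rw [Matrix.exp_conjTranspose, hexp], fun z hz => ?_⟩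
  rw [spectrum_conjTranspose, Set.mem_star] at hz
  obtain ⟨hlt, hgt⟩ := hstrip _ hz
  rw [Complex.star_def, Complex.conj_im] at hlt hgt
  exact ⟨neg_lt.1 hgt, neg_lt_neg_iff.1 hlt⟩

lemma spectrum_conj (hS : IsUnit S) (A : Matrix (Fin n) (Fin n) ℂ) :
    spectrum ℂ (S * A * S⁻¹) = spectrum ℂ A := by
  obtain ⟨u, rfl⟩ := hS
  rw [← Matrix.coe_units_inv]
  exact spectrum.units_conjugate

lemma NoNonposEigenvalue.conj (hA : NoNonposEigenvalue A) (hS : IsUnit S) :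
    NoNonposEigenvalue (S * A * S⁻¹) := by
  rwa [NoNonposEigenvalue, spectrum_conj hS]

lemma principalLog_conj (hA : NoNonposEigenvalue A) (hS : IsUnit S) :
    principalLog (S * A * S⁻¹) = S * principalLog A * S⁻¹ := by
  obtain ⟨hexp, hstrip⟩ := isPrincipalLog_principalLog hA
  refine IsPrincipalLog.principalLog_eq ⟨by rw [Matrix.exp_conj _ _ hS, hexp], ?_⟩
  rwa [SpectrumInStrip, spectrum_conj hS]

end Covariance

section MatPow

variable {n : ℕ} {A S : Matrix (Fin n) (Fin n) ℂ}

lemma matPow_zero (A : Matrix (Fin n) (Fin n) ℂ) : matPow A 0 = 1 := by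
  rw [matPow, mul_zero, NormedSpace.exp_zero]

lemma one_matPow (B : Matrix (Fin n) (Fin n) ℂ) : matPow 1 B = 1 := by
  rw [matPow, isPrincipalLog_one.principalLog_eq, zero_mul, NormedSpace.exp_zero]

lemma matPow_smul_one (hA : NoNonposEigenvalue A) (c : ℂ) :
    matPow A (c • 1) = primaryFunction (fun z => z ^ c) A := by
  rw [matPow, mul_smul_comm, mul_one, exp_smul_principalLog hA]

lemma isPrincipalSqrt_iff_eq_matPow (hA : NoNonposEigenvalue A) (X : Matrix (Fin n) (Fin n) ℂ) :
    IsPrincipalSqrt A X ↔ X = matPow A ((1 / 2 : ℂ) • 1) := by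
  rw [isPrincipalSqrt_iff hA, matPow_smul_one hA, one_div]

lemma matPow_one (hA : NoNonposEigenvalue A) : matPow A 1 = A := by
  rw [matPow, mul_one, (isPrincipalLog_principalLog hA).1]

lemma matPow_mul (hAB : SpectrumInStrip (principalLog A * B)) (C : Matrix (Fin n) (Fin n) ℂ) :
    matPow A (B * C) = matPow (matPow A B) C := by
  have hlog : principalLog (matPow A B) = principalLog A * B :=
    IsPrincipalLog.principalLog_eq ⟨rfl, hAB⟩
  rw [matPow, matPow, hlog, mul_assoc]

lemma matPow_neg_mul_matPow (A B : Matrix (Fin n) (Fin n) ℂ) :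
    matPow A (-B) * matPow A B = 1 := by
  rw [matPow, matPow, mul_neg, ← Matrix.exp_add_of_commute _ _
    (Commute.refl (principalLog A * B)).neg_left, neg_add_cancel, NormedSpace.exp_zero]

lemma matPow_mul_matPow_neg (A B : Matrix (Fin n) (Fin n) ℂ) :
    matPow A B * matPow A (-B) = 1 :=
  mul_eq_one_comm.1 (matPow_neg_mul_matPow A B)

lemma inv_matPow (A B : Matrix (Fin n) (Fin n) ℂ) : (matPow A B)⁻¹ = matPow A (-B) :=
  Matrix.inv_eq_left_inv (matPow_neg_mul_matPow A B)

lemma matPow_neg_one (hA : NoNonposEigenvalue A) : matPow A (-1) = A⁻¹ := by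
  rw [← inv_matPow, matPow_one hA]

lemma conjTranspose_matPow (hA : NoNonposEigenvalue A) (B : Matrix (Fin n) (Fin n) ℂ) :
    (matPow A B).conjTranspose = leftMatPow A.conjTranspose B.conjTranspose := by
  rw [matPow, leftMatPow, principalLog_conjTranspose hA, ← Matrix.conjTranspose_mul,
    Matrix.exp_conjTranspose]

lemma matPow_conj (hA : NoNonposEigenvalue A) (hS : IsUnit S) (B : Matrix (Fin n) (Fin n) ℂ) :
    matPow (S * A * S⁻¹) (S * B * S⁻¹) = S * matPow A B * S⁻¹ := by
  have hdet : IsUnit S.det := (Matrix.isUnit_iff_isUnit_det S).1 hS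
  rw [matPow, matPow, principalLog_conj hA hS, ← Matrix.exp_conj _ _ hS]
  simp only [mul_assoc, Matrix.nonsing_inv_mul_cancel_left _ _ hdet]

end MatPow

end MatrixPower

theorem lemma2p1 (n : ℕ) (A B : Matrix (Fin n) (Fin n) ℂ)
    (hA : MatrixPower.NoNonposEigenvalue A) :
    -- the principal logarithm of `A` is well defined
    (∃! X, MatrixPower.IsPrincipalLog A X) ∧
    -- (i)
    (MatrixPower.matPow A 0 = 1 ∧
      MatrixPower.NoNonposEigenvalue (1 : Matrix (Fin n) (Fin n) ℂ) ∧
      MatrixPower.matPow 1 B = 1) ∧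
    -- (ii)
    ((∀ α : ℝ,
        MatrixPower.matPow A ((α : ℂ) • (1 : Matrix (Fin n) (Fin n) ℂ)) =
          MatrixPower.realPow A α) ∧
      (∀ X : Matrix (Fin n) (Fin n) ℂ, MatrixPower.IsPrincipalSqrt A X ↔
        X = MatrixPower.matPow A ((1 / 2 : ℂ) • (1 : Matrix (Fin n) (Fin n) ℂ))) ∧
      (IsUnit A ∧ MatrixPower.matPow A (-1) = A⁻¹)) ∧
    -- (iii)
    (MatrixPower.SpectrumInStrip (MatrixPower.principalLog A * B) →
      MatrixPower.NoNonposEigenvalue (MatrixPower.matPow A B) ∧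
      ∀ C : Matrix (Fin n) (Fin n) ℂ,
        MatrixPower.matPow A (B * C) = MatrixPower.matPow (MatrixPower.matPow A B) C) ∧
    -- (iv)
    (MatrixPower.matPow A (-B) * MatrixPower.matPow A B = 1 ∧
      MatrixPower.matPow A B * MatrixPower.matPow A (-B) = 1 ∧
      (MatrixPower.matPow A B)⁻¹ = MatrixPower.matPow A (-B)) ∧
    -- (v)
    (MatrixPower.NoNonposEigenvalue A.conjTranspose ∧
      (MatrixPower.matPow A B).conjTranspose =
        MatrixPower.leftMatPow A.conjTranspose B.conjTranspose) ∧
    -- (vi)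
    (∀ S : Matrix (Fin n) (Fin n) ℂ, IsUnit S →
      MatrixPower.NoNonposEigenvalue (S * A * S⁻¹) ∧
      MatrixPower.matPow (S * A * S⁻¹) (S * B * S⁻¹) =
        S * MatrixPower.matPow A B * S⁻¹) := by
  open MatrixPower in
  exact ⟨existsUnique_isPrincipalLog hA,
    ⟨matPow_zero A, noNonposEigenvalue_one, one_matPow B⟩,
    ⟨fun α => matPow_smul_one hA α, isPrincipalSqrt_iff_eq_matPow hA, hA.isUnit,
      matPow_neg_one hA⟩,
    fun hAB => ⟨hAB.noNonposEigenvalue_exp, matPow_mul hAB⟩,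
    ⟨matPow_neg_mul_matPow A B, matPow_mul_matPow_neg A B, inv_matPow A B⟩,
    ⟨hA.conjTranspose, conjTranspose_matPow hA B⟩,
    fun _ hS => ⟨hA.conj hS, matPow_conj hA hS B⟩⟩
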